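/- For all positive integers $m$, $n$, $r$ and every nonnegative integer $a$, the integer $$ 2\sum_{k=1}^{m} k^{2a+1}\binom{m+n}{m+k}^{r}\binom{m+n}{n+k}^{r} $$ is divisible by $\dfrac{mn}{\gcd(m,n)}\dbinom{m+n}{m}$, where $\binom{N}{j}=0$ for integers $j>N\ge 0$. -/

import Mathlib

/-! Write `w_s` for `multinomialWeight m n s`. By Vandermonde, the product of the two binomials is
the sum of the `w_s`. The integer span of the `w_s` is stable under multiplication by `k ^ 2`
(`sq_mul_mem_weightSpan`) and by that product (`choose_mul_choose_mul_mem_weightSpan`), so it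
contains the whole summand divided by `k`. For a single weight, `2 * ∑ k * w_s(k)` telescopes to an
integer multiple of `m * (m + n).choose m`. Exchanging `m` and `n` gives the multiple of `n`, and
the two combine into the lcm. -/

/-- The reciprocal of `(i - j)!`, read as `0` when `j > i`. -/
def invFactorialSub (i j : ℕ) : ℚ := if j ≤ i then ((Nat.factorial (i - j) : ℚ))⁻¹ else 0

/-- `centralWeight s k = 1 / ((s - k)! (s + k)!)`, read as `0` when `k > s`. -/
def centralWeight (s k : ℕ) : ℚ := invFactorialSub s k * ((Nat.factorial (s + k) : ℚ))⁻¹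

/-- The multinomial weight `(m + n)! / ((m - s)! (n - s)! (s - k)! (s + k)!)`. -/
def multinomialWeight (m n s k : ℕ) : ℚ :=
  (Nat.factorial (m + n) : ℚ) * invFactorialSub m s * invFactorialSub n s * centralWeight s k

/-- The integer span of the multinomial weights, as functions of `k`. -/
def weightSpan (m n : ℕ) : Submodule ℤ (ℕ → ℚ) :=
  Submodule.span ℤ (Set.range (multinomialWeight m n))

/-! ### Reciprocal factorials and Vandermonde's identity -/

lemma invFactorialSub_of_le {i j : ℕ} (h : j ≤ i) :
    invFactorialSub i j = ((Nat.factorial (i - j) : ℚ))⁻¹ := if_pos h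

lemma invFactorialSub_of_lt {i j : ℕ} (h : i < j) : invFactorialSub i j = 0 :=
  if_neg (not_le.mpr h)

lemma invFactorialSub_add_left (i j : ℕ) :
    invFactorialSub (j + i) j = ((Nat.factorial i : ℚ))⁻¹ := by
  rw [invFactorialSub_of_le (by omega), Nat.add_sub_cancel_left]

/-- `(i - j) / (i - j)! = 1 / (i - j - 1)!`, with both sides vanishing for `i ≤ j`. -/
lemma sub_mul_invFactorialSub (i j : ℕ) :
    ((i : ℚ) - j) * invFactorialSub i j = invFactorialSub i (j + 1) := by
  rcases lt_trichotomy i j with h | rfl | h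
  · rw [invFactorialSub_of_lt h, invFactorialSub_of_lt (by omega), mul_zero]
  · rw [invFactorialSub_of_lt (Nat.lt_succ_self i), sub_self, zero_mul]
  · obtain ⟨d, rfl⟩ := Nat.exists_eq_add_of_lt h
    rw [show j + d + 1 = j + (d + 1) by ring, invFactorialSub_add_left,
      show j + (d + 1) = (j + 1) + d by ring, invFactorialSub_add_left, Nat.factorial_succ]
    have : (Nat.factorial d : ℚ) ≠ 0 := by positivity
    push_cast
    field_simp
    ring

lemma cast_choose_eq_mul_invFactorialSub (i j : ℕ) :
    (Nat.choose i j : ℚ) =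
      Nat.factorial i * ((Nat.factorial j : ℚ))⁻¹ * invFactorialSub i j := by
  rcases le_or_gt j i with h | h
  · rw [invFactorialSub_of_le h, Nat.cast_choose ℚ h]
    field_simp
  · rw [invFactorialSub_of_lt h, Nat.choose_eq_zero_of_lt h]
    simp

lemma choose_mul_choose_eq_centralWeight (m n k : ℕ) :
    ((Nat.choose (m + n) (m + k) : ℚ)) * Nat.choose (m + n) (n + k) =
      (Nat.factorial (m + n) : ℚ) ^ 2 * (centralWeight m k * centralWeight n k) := by
  have key : ∀ p q : ℕ, invFactorialSub (p + q) (p + k) = invFactorialSub q k := by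
    intro p q
    unfold invFactorialSub
    simp only [add_le_add_iff_left, Nat.add_sub_add_left]
  rw [cast_choose_eq_mul_invFactorialSub, cast_choose_eq_mul_invFactorialSub, key,
    add_comm m n, key]
  unfold centralWeight
  ring

/-- Vandermonde's identity, as the expansion of a product of two central weights. -/
lemma centralWeight_mul_centralWeight (m n k : ℕ) :
    centralWeight m k * centralWeight n k =
      ∑ s ∈ Finset.range (n + 1), ((Nat.factorial (m + n) : ℚ))⁻¹ *
        invFactorialSub m s * invFactorialSub n s * centralWeight s k := by
  rcases lt_or_ge n k with hn | hn
  · rw [centralWeight, centralWeight, invFactorialSub_of_lt hn, zero_mul, mul_zero]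
    refine (Finset.sum_eq_zero fun s hs => ?_).symm
    rw [centralWeight, invFactorialSub_of_lt (i := s) (by simp at hs; omega)]
    simp
  rcases lt_or_ge m k with hm | hm
  · rw [centralWeight, invFactorialSub_of_lt hm, zero_mul, zero_mul]
    refine (Finset.sum_eq_zero fun s hs => ?_).symm
    rcases lt_or_ge s k with h | h
    · rw [centralWeight, invFactorialSub_of_lt h]
      simp
    · rw [invFactorialSub_of_lt (i := m) (j := s) (by omega)]
      simp
  obtain ⟨p, rfl⟩ := Nat.exists_eq_add_of_le hm
  obtain ⟨q, rfl⟩ := Nat.exists_eq_add_of_le hn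
  -- With `m = k + p` and `n = k + q`, the index `i` here corresponds to `s = k + i`; the terms with
  -- `s < k` vanish.
  have vand := Nat.add_choose_eq p (2 * k + q) q
  rw [Finset.Nat.sum_antidiagonal_eq_sum_range_succ_mk] at vand
  have vand' : ((Nat.choose (p + (2 * k + q)) q : ℕ) : ℚ) =
      ∑ i ∈ Finset.range (q + 1), (Nat.choose p i : ℚ) * Nat.choose (2 * k + q) (q - i) := by
    rw [vand]
    push_cast
    rfl
  rw [add_assoc k q 1, Finset.sum_range_add,
    Finset.sum_eq_zero (s := Finset.range k), zero_add]
  · have hL : centralWeight (k + p) k * centralWeight (k + q) k =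
        ((Nat.factorial (k + p + (k + q)) : ℚ))⁻¹ * ((Nat.factorial p : ℚ))⁻¹ *
          ((Nat.factorial (2 * k + q) : ℚ))⁻¹ * (Nat.choose (p + (2 * k + q)) q : ℚ) := by
      rw [cast_choose_eq_mul_invFactorialSub,
        show p + (2 * k + q) = q + (2 * k + p) by ring, invFactorialSub_add_left,
        centralWeight, centralWeight, invFactorialSub_add_left, invFactorialSub_add_left,
        show k + p + (k + q) = q + (2 * k + p) by ring,
        show k + p + k = 2 * k + p by ring, show k + q + k = 2 * k + q by ring]
      field_simp
    rw [hL, vand', Finset.mul_sum]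
    refine Finset.sum_congr rfl fun i hi => ?_
    have hi' : i ≤ q := by simp at hi; omega
    obtain ⟨j, rfl⟩ := Nat.exists_eq_add_of_le hi'
    rw [cast_choose_eq_mul_invFactorialSub, cast_choose_eq_mul_invFactorialSub,
      Nat.add_sub_cancel_left, show 2 * k + (i + j) = j + (2 * k + i) by ring,
      invFactorialSub_add_left, centralWeight, invFactorialSub_add_left,
      show k + (i + j) = (k + i) + j by ring, invFactorialSub_add_left,
      show k + i + k = 2 * k + i by ring]
    have hp : invFactorialSub (k + p) (k + i) = invFactorialSub p i := by
      unfold invFactorialSub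
      simp only [add_le_add_iff_left, Nat.add_sub_add_left]
    rw [hp]
    field_simp
  · intro s hs
    rw [centralWeight, invFactorialSub_of_lt (i := s) (by simpa using hs)]
    simp

/-! ### Stability of the weight span -/

/-- Lowering `s + 1` to `s` multiplies the central weight by `(s + 1 - k) * (s + 1 + k) = (s + 1) ^
2 - k ^ 2`. -/
lemma sq_mul_centralWeight_succ (s k : ℕ) :
    (k : ℚ) ^ 2 * centralWeight (s + 1) k =
      ((s + 1 : ℕ) : ℚ) ^ 2 * centralWeight (s + 1) k - centralWeight s k := by
  have h : centralWeight s k = (((s + 1 : ℕ) : ℚ) - k) * ((s + 1 : ℕ) + k) *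
      centralWeight (s + 1) k := by
    unfold centralWeight
    have h1 := sub_mul_invFactorialSub (s + 1) k
    have h2 : invFactorialSub (s + 1) (k + 1) = invFactorialSub s k := by
      unfold invFactorialSub
      simp only [add_le_add_iff_right, Nat.add_sub_add_right]
    rw [h2] at h1
    rw [← h1, show s + 1 + k = (s + k) + 1 by ring, Nat.factorial_succ]
    have : ((s : ℚ) + k + 1) ≠ 0 := by positivity
    push_cast
    field_simp
    ring
  rw [h]
  ring

lemma sq_mul_centralWeight_zero (k : ℕ) : (k : ℚ) ^ 2 * centralWeight 0 k = 0 := by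
  rcases Nat.eq_zero_or_pos k with rfl | h
  · simp
  · rw [centralWeight, invFactorialSub_of_lt h]
    simp

lemma invFactorialSub_eq_mul_succ (m s : ℕ) :
    invFactorialSub m (s + 1) = (((m : ℤ) - s : ℤ) : ℚ) * invFactorialSub m s := by
  rw [← sub_mul_invFactorialSub]
  push_cast
  rfl

lemma sq_mul_mem_weightSpan {m n : ℕ} {f : ℕ → ℚ} (hf : f ∈ weightSpan m n) :
    (fun k : ℕ => (k : ℚ) ^ 2 * f k) ∈ weightSpan m n := by
  have key : weightSpan m n ≤ (weightSpan m n).comap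
      (LinearMap.mulLeft ℤ (fun k : ℕ => (k : ℚ) ^ 2)) := by
    refine Submodule.span_le.mpr ?_
    rintro _ ⟨s, rfl⟩
    change (fun k : ℕ => (k : ℚ) ^ 2) * multinomialWeight m n s ∈ weightSpan m n
    rcases s with _ | s
    -- The weight with `s = 0` is supported at `k = 0`, where `k ^ 2` vanishes.
    · convert (weightSpan m n).zero_mem using 1
      funext k
      have := sq_mul_centralWeight_zero k
      simp only [Pi.mul_apply, multinomialWeight, Pi.zero_apply]
      linear_combination (Nat.factorial (m + n) : ℚ) * invFactorialSub m 0 *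
        invFactorialSub n 0 * this
    · have h1 : multinomialWeight m n (s + 1) ∈ weightSpan m n :=
        Submodule.subset_span ⟨_, rfl⟩
      have h2 : multinomialWeight m n s ∈ weightSpan m n := Submodule.subset_span ⟨_, rfl⟩
      -- The factor `(m - s) * (n - s)` absorbs the change of `1 / ((m - s)! (n - s)!)` from `s` to
      -- `s + 1`.
      convert (weightSpan m n).sub_mem ((weightSpan m n).smul_mem (((s : ℤ) + 1) ^ 2) h1)
        ((weightSpan m n).smul_mem (((m : ℤ) - s) * (n - s)) h2) using 1
      funext k
      have h := sq_mul_centralWeight_succ s k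
      have e1 := invFactorialSub_eq_mul_succ m s
      have e2 := invFactorialSub_eq_mul_succ n s
      simp only [Pi.mul_apply, Pi.sub_apply, Pi.smul_apply]
      simp only [multinomialWeight, zsmul_eq_mul]
      rw [e1, e2]
      push_cast at h ⊢
      linear_combination (Nat.factorial (m + n) : ℚ) * ((m : ℚ) - s) * invFactorialSub m s *
        (((n : ℚ) - s) * invFactorialSub n s) * h
  exact key hf

/-- The connection coefficients of multiplication by a product of two binomial coefficients,
with respect to the multinomial weights, are integers. -/
lemma exists_int_connection_coeff (m n s t q : ℕ) :
    ∃ z : ℤ, (Nat.factorial (m + n) : ℚ) ^ 2 * (invFactorialSub m s * invFactorialSub n s) *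
      (((Nat.factorial (m + s) : ℚ))⁻¹ * invFactorialSub m t * invFactorialSub s t) *
      (((Nat.factorial (n + t) : ℚ))⁻¹ * invFactorialSub n q * invFactorialSub t q) =
      z * (invFactorialSub m q * invFactorialSub n q) := by
  by_cases h : q ≤ t ∧ t ≤ s ∧ s ≤ m ∧ s ≤ n
  · obtain ⟨h1, h2, h3, h4⟩ := h
    -- Regrouping the factorials exhibits the quotient as a product of four binomials; `(s - q)!`
    -- cancels between the last two.
    refine ⟨(Nat.choose (m + n) (m + s) * Nat.choose (n + m) (n + t) *
      (Nat.choose (m - q) (m - s) * Nat.choose (s - q) (s - t)) : ℕ), ?_⟩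
    have key : ∀ a b c : ℕ, invFactorialSub (a + b) (a + c) = invFactorialSub b c := by
      intro a b c
      unfold invFactorialSub
      simp only [add_le_add_iff_left, Nat.add_sub_add_left]
    push_cast
    rw [cast_choose_eq_mul_invFactorialSub (m + n), cast_choose_eq_mul_invFactorialSub (n + m),
      key, key, cast_choose_eq_mul_invFactorialSub, cast_choose_eq_mul_invFactorialSub,
      invFactorialSub_of_le (show m - s ≤ m - q by omega),
      invFactorialSub_of_le (show s - t ≤ s - q by omega),
      show m - q - (m - s) = s - q by omega, show s - q - (s - t) = t - q by omega,
      invFactorialSub_of_le h3, invFactorialSub_of_le h2, invFactorialSub_of_le h1,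
      invFactorialSub_of_le (show q ≤ m by omega), add_comm n m]
    field_simp
  · refine ⟨0, ?_⟩
    have : invFactorialSub t q * invFactorialSub s t * (invFactorialSub m s * invFactorialSub n s)
        = 0 := by
      by_cases h1 : q ≤ t
      · by_cases h2 : t ≤ s
        · by_cases h3 : s ≤ m
          · rw [invFactorialSub_of_lt (i := n) (j := s) (by omega)]
            simp
          · rw [invFactorialSub_of_lt (i := m) (j := s) (by omega)]
            simp
        · rw [invFactorialSub_of_lt (i := s) (j := t) (by omega)]
          simp
      · rw [invFactorialSub_of_lt (i := t) (j := q) (by omega)]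
        simp
    push_cast
    linear_combination (Nat.factorial (m + n) : ℚ) ^ 2 *
      (((Nat.factorial (m + s) : ℚ))⁻¹ * invFactorialSub m t) *
      (((Nat.factorial (n + t) : ℚ))⁻¹ * invFactorialSub n q) * this

lemma choose_mul_choose_mul_mem_weightSpan {m n : ℕ} {f : ℕ → ℚ} (hf : f ∈ weightSpan m n) :
    (fun k : ℕ => (Nat.choose (m + n) (m + k) : ℚ) * Nat.choose (m + n) (n + k) * f k) ∈
      weightSpan m n := by
  have key : weightSpan m n ≤ (weightSpan m n).comap (LinearMap.mulLeft ℤ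
      (fun k : ℕ => (Nat.choose (m + n) (m + k) : ℚ) * Nat.choose (m + n) (n + k))) := by
    refine Submodule.span_le.mpr ?_
    rintro _ ⟨s, rfl⟩
    change (fun k : ℕ => (Nat.choose (m + n) (m + k) : ℚ) * Nat.choose (m + n) (n + k)) *
      multinomialWeight m n s ∈ weightSpan m n
    choose z hz using exists_int_connection_coeff m n s
    convert (weightSpan m n).sum_mem (t := Finset.range (s + 1)) (f := fun t =>
      ∑ q ∈ Finset.range (t + 1), z t q • multinomialWeight m n q) (fun t _ =>
        (weightSpan m n).sum_mem fun q _ => (weightSpan m n).smul_mem _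
          (Submodule.subset_span ⟨q, rfl⟩)) using 1
    funext k
    simp only [Pi.mul_apply, Finset.sum_apply, Pi.smul_apply]
    simp only [zsmul_eq_mul]
    -- Vandermonde is applied twice: to the central weights of `m` and `s`, giving index `t`, then
    -- to those of `n` and `t`, giving `q`.
    have e : (Nat.choose (m + n) (m + k) : ℚ) * Nat.choose (m + n) (n + k) *
        multinomialWeight m n s k = (Nat.factorial (m + n) : ℚ) ^ 3 * (invFactorialSub m s *
          invFactorialSub n s) * ((centralWeight m k * centralWeight s k) *
          centralWeight n k) := by
      rw [choose_mul_choose_eq_centralWeight, multinomialWeight]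
      ring
    rw [e, centralWeight_mul_centralWeight m s, Finset.sum_mul, Finset.mul_sum]
    refine Finset.sum_congr rfl fun t _ => ?_
    rw [mul_assoc _ (centralWeight t k), mul_comm (centralWeight t k),
      centralWeight_mul_centralWeight n t, Finset.mul_sum, Finset.mul_sum]
    refine Finset.sum_congr rfl fun q _ => ?_
    rw [multinomialWeight]
    linear_combination (Nat.factorial (m + n) : ℚ) * centralWeight q k * hz t q
  exact key hf

lemma choose_mul_choose_mem_weightSpan (m n : ℕ) :
    (fun k : ℕ => (Nat.choose (m + n) (m + k) : ℚ) * Nat.choose (m + n) (n + k)) ∈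
      weightSpan m n := by
  convert (weightSpan m n).sum_mem (t := Finset.range (n + 1))
    (f := fun s => multinomialWeight m n s) (fun s _ => Submodule.subset_span ⟨s, rfl⟩) using 1
  funext k
  rw [choose_mul_choose_eq_centralWeight, centralWeight_mul_centralWeight, Finset.sum_apply,
    Finset.mul_sum]
  refine Finset.sum_congr rfl fun s _ => ?_
  rw [multinomialWeight]
  field_simp

lemma pow_mul_choose_pow_mem_weightSpan (m n r a : ℕ) :
    (fun k : ℕ => (k : ℚ) ^ (2 * a) * ((Nat.choose (m + n) (m + k) : ℚ) *
      Nat.choose (m + n) (n + k)) ^ (r + 1)) ∈ weightSpan m n := by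
  induction a with
  | zero =>
    induction r with
    | zero => simpa using choose_mul_choose_mem_weightSpan m n
    | succ r ih =>
      convert choose_mul_choose_mul_mem_weightSpan ih using 2 with k
      ring
  | succ a ih =>
    convert sq_mul_mem_weightSpan ih using 2 with k
    ring

/-! ### Telescoping sums and divisibility -/

/-- The sum telescopes because `2 * k = (s + 1 + k) - (s + 1 - k)`; the boundary term `1 / ((s - M)!
(s + 1 + M)!)` vanishes once `M > s`. -/
lemma two_mul_sum_mul_centralWeight_succ {s N : ℕ} (h : s + 1 ≤ N) :
    2 * ∑ k ∈ Finset.Icc 1 N, (k : ℚ) * centralWeight (s + 1) k =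
      ((Nat.factorial s : ℚ))⁻¹ * ((Nat.factorial (s + 1) : ℚ))⁻¹ := by
  have partialSum : ∀ M : ℕ, 2 * ∑ k ∈ Finset.Icc 1 M, (k : ℚ) * centralWeight (s + 1) k =
      ((Nat.factorial s : ℚ))⁻¹ * ((Nat.factorial (s + 1) : ℚ))⁻¹ -
        invFactorialSub (s + 1) (M + 1) * ((Nat.factorial (s + 1 + M) : ℚ))⁻¹ := by
    intro M
    induction M with
    | zero =>
      rw [zero_add, invFactorialSub_of_le (by omega)]
      simp
    | succ M ih =>
      rw [Finset.sum_Icc_succ_top (by omega), mul_add, ih, ← sub_mul_invFactorialSub _ (M + 1),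
        centralWeight, ← add_assoc (s + 1) M 1, Nat.factorial_succ (s + 1 + M)]
      have : (((s + 1 + M : ℕ) : ℚ) + 1) ≠ 0 := by positivity
      push_cast at this ⊢
      field_simp
      ring
  rw [partialSum, invFactorialSub_of_lt (by omega)]
  ring

/-- A nonzero weight has `s ≤ min m n` and vanishes for `k > s`, so the range need only reach one of
`m`, `n`. This lets both orders of the pair share one range. -/
lemma exists_int_two_mul_sum_multinomialWeight {m n : ℕ} (hm : 0 < m) (s N : ℕ)
    (hN : m ≤ N ∨ n ≤ N) :
    ∃ z : ℤ, 2 * ∑ k ∈ Finset.Icc 1 N, (k : ℚ) * multinomialWeight m n s k =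
      z * ((m : ℚ) * Nat.choose (m + n) m) := by
  by_cases hs : s ≤ m ∧ s ≤ n
  · obtain ⟨h1, h2⟩ := hs
    rcases s with _ | s
    · refine ⟨0, ?_⟩
      rw [Finset.sum_eq_zero]
      · simp
      · intro k hk
        rw [multinomialWeight, centralWeight, invFactorialSub_of_lt (i := 0) (j := k)
          (by simp at hk; omega)]
        simp
    · refine ⟨(Nat.choose (m - 1) s * Nat.choose n (s + 1) : ℕ), ?_⟩
      have e : 2 * ∑ k ∈ Finset.Icc 1 N, (k : ℚ) * multinomialWeight m n (s + 1) k =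
          (Nat.factorial (m + n) : ℚ) * invFactorialSub m (s + 1) * invFactorialSub n (s + 1) *
            (2 * ∑ k ∈ Finset.Icc 1 N, (k : ℚ) * centralWeight (s + 1) k) := by
        rw [Finset.mul_sum, Finset.mul_sum, Finset.mul_sum]
        refine Finset.sum_congr rfl fun k _ => ?_
        rw [multinomialWeight]
        ring
      rw [e, two_mul_sum_mul_centralWeight_succ (by omega)]
      obtain ⟨p, rfl⟩ := Nat.exists_eq_add_of_le' hm
      have h3 : invFactorialSub (p + 1) (s + 1) = invFactorialSub p s := by
        unfold invFactorialSub
        simp only [add_le_add_iff_right, Nat.add_sub_add_right]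
      push_cast
      rw [h3, cast_choose_eq_mul_invFactorialSub p,
        cast_choose_eq_mul_invFactorialSub n, cast_choose_eq_mul_invFactorialSub (p + 1 + n),
        invFactorialSub_add_left, Nat.factorial_succ p]
      push_cast
      field_simp
  · refine ⟨0, ?_⟩
    rw [Finset.sum_eq_zero]
    · simp
    · intro k _
      rw [multinomialWeight]
      rcases not_and_or.mp hs with h | h
      · rw [invFactorialSub_of_lt (i := m) (j := s) (by omega)]
        simp
      · rw [invFactorialSub_of_lt (i := n) (j := s) (by omega)]
        simp

lemma exists_int_two_mul_sum_of_mem_weightSpan {m n N : ℕ} (hm : 0 < m) (hN : m ≤ N ∨ n ≤ N)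
    {f : ℕ → ℚ} (hf : f ∈ weightSpan m n) :
    ∃ z : ℤ, 2 * ∑ k ∈ Finset.Icc 1 N, (k : ℚ) * f k =
      z * ((m : ℚ) * Nat.choose (m + n) m) := by
  induction hf using Submodule.span_induction with
  | mem f hf =>
    obtain ⟨s, rfl⟩ := hf
    exact exists_int_two_mul_sum_multinomialWeight hm s N hN
  | zero => exact ⟨0, by simp⟩
  | add f g _ _ hf hg =>
    obtain ⟨y, hy⟩ := hf
    obtain ⟨z, hz⟩ := hg
    refine ⟨y + z, ?_⟩
    simp only [Pi.add_apply, mul_add, Finset.sum_add_distrib]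
    push_cast
    linear_combination hy + hz
  | smul c f _ hf =>
    obtain ⟨y, hy⟩ := hf
    refine ⟨c * y, ?_⟩
    simp only [Pi.smul_apply]
    simp only [zsmul_eq_mul, mul_left_comm _ (c : ℚ), ← Finset.mul_sum]
    push_cast
    linear_combination (c : ℚ) * hy

lemma mul_choose_dvd_two_mul_sum {m n N : ℕ} (hm : 0 < m) (hN : m ≤ N ∨ n ≤ N) (r a : ℕ) :
    m * Nat.choose (m + n) m ∣ 2 * ∑ k ∈ Finset.Icc 1 N,
      k ^ (2 * a + 1) * Nat.choose (m + n) (m + k) ^ (r + 1) *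
        Nat.choose (m + n) (n + k) ^ (r + 1) := by
  obtain ⟨z, hz⟩ := exists_int_two_mul_sum_of_mem_weightSpan hm hN
    (pow_mul_choose_pow_mem_weightSpan m n r a)
  rw [← Int.natCast_dvd_natCast]
  refine ⟨z, ?_⟩
  rw [← Int.cast_inj (α := ℚ)]
  push_cast
  rw [mul_comm _ (z : ℚ), ← hz]
  congr 1
  refine Finset.sum_congr rfl fun k _ => ?_
  ring

theorem corollary6p1 (m n r a : ℕ) (hm : 0 < m) (hn : 0 < n) (hr : 0 < r) :
    (m * n / Nat.gcd m n) * Nat.choose (m + n) m ∣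
      2 * ∑ k ∈ Finset.Icc 1 m,
        k ^ (2 * a + 1) * Nat.choose (m + n) (m + k) ^ r * Nat.choose (m + n) (n + k) ^ r := by
  obtain ⟨r, rfl⟩ := Nat.exists_eq_add_of_le' hr
  change Nat.lcm m n * _ ∣ _
  rw [← Nat.lcm_mul_right]
  refine Nat.lcm_dvd (mul_choose_dvd_two_mul_sum hm (Or.inl le_rfl) r a) ?_
  -- The roles of `m` and `n` are exchanged, but the sum still stops at `m`.
  have h := mul_choose_dvd_two_mul_sum (n := m) hn (Or.inr (le_refl m)) r a
  rw [add_comm n m, ← Nat.choose_symm_add] at h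
  simpa only [mul_right_comm] using h
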